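/- Let $\mathbf{Sp}$ be the simplicial category of Kan complexes (the full simplicial subcategory of $\mathbf{SSet}$ on the fibrant simplicial sets). In a simplicial category $\mathcal K$, the homotopy category $\mathrm{Ho}(\mathcal K)$ has the objects of $\mathcal K$ and $\pi_0(\hom_{\mathcal K}(X,Y))$ as its set of morphisms $X\to Y$; a morphism of $\mathcal K$ is a homotopy equivalence if it becomes an isomorphism in $\mathrm{Ho}(\mathcal K)$, and $X\simeq Y$ means that $X$ and $Y$ are isomorphic in $\mathrm{Ho}(\mathcal K)$. For a small category $\mathcal C$ and a functor $F:\mathcal C\to\mathbf{SSet}$, the simplicial homotopy limit $\mathrm{holim}_s F$ is the simplicial set of simplicial natural transformations from $B(\mathcal C\downarrow -)$ to $F$, where $B$ is the nerve. A simplicial category is fibrant if all its hom-objects are Kan complexes. A fibrant homotopy colimit of a diagram $D:\mathcal D\to\mathcal K$ ($\mathcal D$ a small category, $\mathcal K$ a fibrant simplicial category) is an object $\mathrm{hocolim}_f D$ of $\mathcal K$ for which there are homotopy equivalences $$\delta_A:\hom(\mathrm{hocolim}_f D,A)\to\mathrm{holim}_s\hom(D,A),$$ simplicially natural in $A\in\mathcal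 K$. **Proposition 4.2.** In $\mathbf{Sp}$, fibrant homotopy colimits distribute over binary products. That is, $\mathbf{Sp}$ is a fibrant simplicial category which has binary products (in the simplicially enriched sense) and fibrant homotopy colimits of all small diagrams, and for all small categories $\mathcal D_1,\mathcal D_2$ and all functors $D_1:\mathcal D_1\to\mathbf{Sp}$, $D_2:\mathcal D_2\to\mathbf{Sp}$, $$\mathrm{hocolim}_f(D_1\times D_2)\simeq \mathrm{hocolim}_f D_1\times\mathrm{hocolim}_f D_2,$$ where $D_1\times D_2:\mathcal D_1\times\mathcal D_2\to\mathbf{Sp}$ is the diagram $(d_1,d_2)\mapsto D_1d_1\times D_2d_2$, and this holds for every choice of the three fibrant homotopy colimits. -/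

import Mathlib

open CategoryTheory MonoidalCategory CartesianMonoidalCategory Simplicial Opposite Limits

universe v u

namespace HomotopyColimits

/-! ### Homotopy equivalences in a simplicial category -/

section HomotopyCategory

variable {K : Type u} [Category.{v} K] [SimplicialCategory K]

/-- The class of a morphism `f : X ⟶ Y` of a simplicial category in
`π₀ (hom (X, Y))`, the set of morphisms `X ⟶ Y` of the homotopy category `Ho K`. -/
def hoClass {X Y : K} (f : X ⟶ Y) : SSet.π₀ (SimplicialCategory.sHom X Y) :=
  SSet.π₀.mk (SimplicialCategory.homEquiv' X Y f)

/-- A morphism of a simplicial category is a homotopy equivalence if it becomes an isomorphism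
in `Ho K`. (Every morphism of `Ho K` is the class of a morphism of `K`.) -/
def IsHomotopyEquivalence {X Y : K} (f : X ⟶ Y) : Prop :=
  ∃ g : Y ⟶ X, hoClass (f ≫ g) = hoClass (𝟙 X) ∧ hoClass (g ≫ f) = hoClass (𝟙 Y)

/-- `X ≃ Y`: the objects `X` and `Y` are isomorphic in `Ho K`. -/
def HomotopyEquivalent (X Y : K) : Prop :=
  ∃ f : X ⟶ Y, IsHomotopyEquivalence f

end HomotopyCategory

/-! ### Simplicial homotopy limits of simplicial sets -/

section Holim

variable {C : Type v} [SmallCategory C]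

/-- The limit of `F : C ⥤ SSet` weighted by `W : C ⥤ SSet`, i.e. the simplicial set `hom (W, F)` of
simplicial natural transformations; its `n`-simplices are the natural transformations
`W × Δ[n] ⟶ F`. -/
def weightedLimit (W F : C ⥤ SSet.{v}) : SSet.{v} where
  obj n := W ⊗ (Functor.const C).obj (SSet.stdSimplex.obj n.unop) ⟶ F
  map f := TypeCat.ofHom fun φ => W ◁ (Functor.const C).map (SSet.stdSimplex.map f.unop) ≫ φ
  map_id n := by
    refine ConcreteCategory.hom_ext _ _ fun φ => ?_
    change W ◁ (Functor.const C).map (SSet.stdSimplex.map (𝟙 n.unop)) ≫ φ = φ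
    have h : SSet.stdSimplex.{v}.map (𝟙 n.unop) = 𝟙 _ := CategoryTheory.Functor.map_id _ _
    rw [h, CategoryTheory.Functor.map_id, MonoidalCategory.whiskerLeft_id, Category.id_comp]
  map_comp f g := by
    refine ConcreteCategory.hom_ext _ _ fun φ => ?_
    change W ◁ (Functor.const C).map (SSet.stdSimplex.map (g.unop ≫ f.unop)) ≫ φ =
      W ◁ (Functor.const C).map (SSet.stdSimplex.map g.unop) ≫
        W ◁ (Functor.const C).map (SSet.stdSimplex.map f.unop) ≫ φ
    rw [SSet.stdSimplex.map_comp, Functor.map_comp, MonoidalCategory.whiskerLeft_comp,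
      Category.assoc]

variable (C) in
/-- The weight `B (C ↓ -) : C ⥤ SSet`, which sends `c` to the nerve of the category of objects
over `c`. -/
def holimWeight : C ⥤ SSet.{v} :=
  Over.mapFunctor C ⋙ nerveFunctor

/-- The simplicial homotopy limit of a diagram of simplicial sets. -/
def holimS (F : C ⥤ SSet.{v}) : SSet.{v} :=
  weightedLimit (holimWeight C) F

end Holim

/-! ### Fibrant homotopy colimits in a simplicial category -/

section Hocolim

variable {K : Type u} [Category.{v} K] [SimplicialCategory K]
  {J : Type v} [SmallCategory J]

/-- The diagram `hom (D, A) : Jᵒᵖ ⥤ SSet`, which sends `j` to `hom (D j, A)`. -/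
noncomputable def homDiagram (D : J ⥤ K) (A : K) : Jᵒᵖ ⥤ SSet.{v} :=
  D.op ⋙ (SimplicialCategory.sHomFunctor K).flip.obj A

/-- The action of `hom (A, A')` on the simplicial sets `holim hom (D, A)` given by composition,
which makes `A ↦ holim hom (D, A)` a simplicial functor: a pair consisting of
`φ : B (Jᵒᵖ ↓ -) × Δ[n] ⟶ hom (D, A)` and `y : Δ[n] ⟶ hom (A, A')` is sent to
`(w, t) ↦ φ (w, t) ≫ y t`. -/
noncomputable def holimAction (D : J ⥤ K) (A A' : K) :
    holimS (homDiagram D A) ⊗ SimplicialCategory.sHom A A' ⟶ holimS (homDiagram D A') where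
  app n := TypeCat.ofHom fun p =>
    { app := fun j =>
        lift (p.1.app j) (snd _ _ ≫ SSet.yonedaEquiv.symm p.2) ≫
          SimplicialCategory.sHomComp (D.obj j.unop) A A'
      naturality := fun j j' f => by
        have h := p.1.naturality f
        change _ = _ ≫ eHomWhiskerRight SSet (D.map f.unop) A at h
        change _ = (_ ≫ eComp SSet _ _ _) ≫ eHomWhiskerRight SSet (D.map f.unop) A'
        refine Eq.trans ?_ (Category.assoc _ _ _).symm
        refine Eq.trans ?_ (congrArg (fun z => _ ≫ z) (eComp_eHomWhiskerRight SSet _ _ _).symm)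
        refine (Category.assoc _ _ _).symm.trans (Eq.trans ?_ (Category.assoc _ _ _))
        refine congrArg (fun z => z ≫ eComp SSet _ _ _) ?_
        refine (comp_lift _ _ _).trans (Eq.trans ?_ (lift_whiskerRight _ _ _).symm)
        rw [h]
        rfl }
  naturality n m g := by
    ext p
    apply NatTrans.ext
    funext j
    refine Eq.trans ?_ (Category.assoc _ _ _)
    refine congrArg (fun z => z ≫ SimplicialCategory.sHomComp _ _ _) ?_
    refine Eq.trans ?_ (comp_lift _ _ _).symm
    refine congrArg (fun z => lift _ z) ?_
    change _ ≫ SSet.yonedaEquiv.symm ((SimplicialCategory.sHom A A').map g.unop.op p.2) = _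
    rw [← SSet.yonedaEquiv_symm_naturality_left]
    rfl

/-- A fibrant homotopy colimit structure on the object `H` for the diagram `D`: homotopy equivalences
`δ A : hom (H, A) ⟶ holim hom (D, A)`, simplicially natural in `A`. -/
structure FibrantHocolim (D : J ⥤ K) (H : K) where
  /-- the comparison maps -/
  δ (A : K) : SimplicialCategory.sHom H A ⟶ holimS (homDiagram D A)
  natural (A A' : K) :
    SimplicialCategory.sHomComp H A A' ≫ δ A' =
      δ A ▷ SimplicialCategory.sHom A A' ≫ holimAction D A A'
  isHomotopyEquivalence (A : K) : IsHomotopyEquivalence (δ A)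

/-- `H` is a fibrant homotopy colimit of the diagram `D`. -/
def IsFibrantHocolim (D : J ⥤ K) (H : K) : Prop :=
  Nonempty (FibrantHocolim D H)

end Hocolim

/-! ### Distributivity over binary products -/

section Distributivity

variable {K : Type u} [Category.{v} K]

/-- The diagram `D₁ × D₂ : J₁ × J₂ ⥤ K` which sends `(j₁, j₂)` to `D₁ j₁ × D₂ j₂`. -/
noncomputable def prodDiagram [HasBinaryProducts K] {J₁ J₂ : Type v} [SmallCategory J₁]
    [SmallCategory J₂] (D₁ : J₁ ⥤ K) (D₂ : J₂ ⥤ K) : J₁ × J₂ ⥤ K where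
  obj j := D₁.obj j.1 ⨯ D₂.obj j.2
  map f := prod.map (D₁.map f.1) (D₂.map f.2)

variable (K) [SimplicialCategory K]

/-- A simplicial category is fibrant if all its hom-objects are Kan complexes. -/
def IsFibrantSimplicialCategory : Prop :=
  ∀ A B : K, SSet.KanComplex (SimplicialCategory.sHom A B)

/-- Every small diagram has a fibrant homotopy colimit. -/
def HasFibrantHocolims : Prop :=
  ∀ (J : Type v) [SmallCategory J] (D : J ⥤ K), ∃ H : K, IsFibrantHocolim D H

/-- The simplicial category `K` is fibrant, it has fibrant homotopy colimits and (simplicially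
enriched) binary products, and fibrant homotopy colimits distribute over binary products in `K`. -/
structure HocolimsDistributeOverBinaryProducts : Prop where
  fibrant : IsFibrantSimplicialCategory K
  hasFibrantHocolims : HasFibrantHocolims K
  hasBinaryProducts : Enriched.HasConicalLimitsOfShape (Discrete WalkingPair) SSet.{v} K
  distribute (J₁ J₂ : Type v) [SmallCategory J₁] [SmallCategory J₂] (D₁ : J₁ ⥤ K) (D₂ : J₂ ⥤ K)
    (H₁ H₂ H : K) (h₁ : IsFibrantHocolim D₁ H₁) (h₂ : IsFibrantHocolim D₂ H₂)
    (h : IsFibrantHocolim (prodDiagram D₁ D₂) H) :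
    HomotopyEquivalent H (H₁ ⨯ H₂)

end Distributivity

/-- The simplicial category `Sp` of Kan complexes, the full simplicial subcategory of `SSet` on the
fibrant objects. -/
abbrev Sp : Type (v + 1) :=
  ObjectProperty.FullSubcategory fun X : SSet.{v} => SSet.KanComplex X

end HomotopyColimits

namespace HomotopyColimits

/-! ### Homotopy classes of morphisms in a simplicial category -/

section

variable {K : Type u} [Category.{v} K] [SimplicialCategory K]

/-! The proof builds one explicit model that visibly commutes with products, then transfers the
result to every choice by uniqueness. For a diagram `F` of simplicial sets, the bar construction
`hocolimS F` is the colimit of `F` weighted by `holimWeight Jᵒᵖ`, so `hom (hocolimS F, A)` is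
isomorphic to `holimS` of `hom (F, A)` for every `A` (`bijective_cocomparison`). If `i : hocolimS F
⟶ H` is anodyne with `H` Kan, restriction along `i` is a homotopy equivalence on mapping spaces into
Kan complexes (`isHomotopyEquivalence_eHomWhiskerRight`). Hence `H` is a fibrant homotopy colimit
(`isFibrantHocolim_of_anodyne`), and any two are homotopy equivalent by a Yoneda argument on `π₀`
(`IsFibrantHocolim.homotopyEquivalent`). The bar construction commutes with products on the nose
(`hocolimTensorIso`), and products preserve anodyne maps and Kan complexes. So the product of models
for `D₁` and `D₂` is a model for `D₁ × D₂`. -/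

lemma homEquiv'_comp {X Y Z : K} (f : X ⟶ Y) (g : Y ⟶ Z) :
    SimplicialCategory.homEquiv' X Z (f ≫ g) =
      (SimplicialCategory.sHomComp X Y Z).app _
        (SimplicialCategory.homEquiv' X Y f, SimplicialCategory.homEquiv' Y Z g) := by
  change (eHomEquiv SSet (f ≫ g)).app _ PUnit.unit = _
  rw [eHomEquiv_comp]
  rfl

lemma eHomWhiskerLeft_homEquiv' {X Y Z : K} (f : X ⟶ Y) (g : Y ⟶ Z) :
    (eHomWhiskerLeft SSet X g).app _ (SimplicialCategory.homEquiv' X Y f) =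
      SimplicialCategory.homEquiv' X Z (f ≫ g) := by
  rw [homEquiv'_comp]
  rfl

lemma eHomWhiskerRight_homEquiv' {X Y Z : K} (f : X ⟶ Y) (g : Y ⟶ Z) :
    (eHomWhiskerRight SSet f Z).app _ (SimplicialCategory.homEquiv' Y Z g) =
      SimplicialCategory.homEquiv' X Z (f ≫ g) := by
  rw [homEquiv'_comp]
  rfl

lemma mapπ₀_eHomWhiskerLeft_hoClass {X Y Z : K} (f : X ⟶ Y) (g : Y ⟶ Z) :
    SSet.mapπ₀ (eHomWhiskerLeft SSet X g) (hoClass f) = hoClass (f ≫ g) := by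
  rw [hoClass, SSet.mapπ₀_mk, eHomWhiskerLeft_homEquiv']
  rfl

lemma mapπ₀_eHomWhiskerRight_hoClass {X Y Z : K} (f : X ⟶ Y) (g : Y ⟶ Z) :
    SSet.mapπ₀ (eHomWhiskerRight SSet f Z) (hoClass g) = hoClass (f ≫ g) := by
  rw [hoClass, SSet.mapπ₀_mk, eHomWhiskerRight_homEquiv']
  rfl

lemma hoClass_surjective {X Y : K} : Function.Surjective (hoClass : (X ⟶ Y) → _) :=
  SSet.π₀.mk_surjective.comp (SimplicialCategory.homEquiv' X Y).surjective

lemma hoClass_comp_right {X Y Z : K} {f f' : X ⟶ Y} (h : hoClass f = hoClass f') (g : Y ⟶ Z) :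
    hoClass (f ≫ g) = hoClass (f' ≫ g) := by
  rw [← mapπ₀_eHomWhiskerLeft_hoClass, h, mapπ₀_eHomWhiskerLeft_hoClass]

lemma hoClass_comp_left {X Y Z : K} (f : X ⟶ Y) {g g' : Y ⟶ Z} (h : hoClass g = hoClass g') :
    hoClass (f ≫ g) = hoClass (f ≫ g') := by
  rw [← mapπ₀_eHomWhiskerRight_hoClass, h, mapπ₀_eHomWhiskerRight_hoClass]

lemma IsHomotopyEquivalence.of_isIso {X Y : K} (f : X ⟶ Y) [IsIso f] :
    IsHomotopyEquivalence f :=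
  ⟨inv f, by simp, by simp⟩

lemma IsHomotopyEquivalence.comp {X Y Z : K} {f : X ⟶ Y} {g : Y ⟶ Z}
    (hf : IsHomotopyEquivalence f) (hg : IsHomotopyEquivalence g) :
    IsHomotopyEquivalence (f ≫ g) := by
  obtain ⟨f', hf₁, hf₂⟩ := hf
  obtain ⟨g', hg₁, hg₂⟩ := hg
  refine ⟨g' ≫ f', ?_, ?_⟩
  · have := hoClass_comp_left f (hoClass_comp_right hg₁ f')
    simpa [hf₁] using this
  · have := hoClass_comp_left g' (hoClass_comp_right hf₂ g)
    simpa [hg₂] using this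

lemma HomotopyEquivalent.of_iso {X Y : K} (e : X ≅ Y) : HomotopyEquivalent X Y :=
  ⟨e.hom, .of_isIso _⟩

lemma HomotopyEquivalent.symm {X Y : K} (h : HomotopyEquivalent X Y) :
    HomotopyEquivalent Y X := by
  obtain ⟨f, g, h₁, h₂⟩ := h
  exact ⟨g, f, h₂, h₁⟩

lemma HomotopyEquivalent.trans {X Y Z : K} (h : HomotopyEquivalent X Y)
    (h' : HomotopyEquivalent Y Z) : HomotopyEquivalent X Z := by
  obtain ⟨f, hf⟩ := h
  obtain ⟨g, hg⟩ := h'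
  exact ⟨f ≫ g, hf.comp hg⟩

end

/-! ### Homotopies between maps of simplicial sets -/

section

lemma functorHomEquiv_comp_left {X Y Z T : SSet.{v}} (f : T ⟶ Y)
    (k : Y ⟶ SimplicialCategory.sHom X Z) :
    FunctorToTypes.functorHomEquiv X T Z (f ≫ k) =
      X ◁ f ≫ FunctorToTypes.functorHomEquiv X Y Z k := rfl

lemma functorHomEquiv_eHomWhiskerRight {X X' Y Z : SSet.{v}} (f : X ⟶ X')
    (k : Y ⟶ SimplicialCategory.sHom X' Z) :
    FunctorToTypes.functorHomEquiv X Y Z (k ≫ eHomWhiskerRight SSet f Z) =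
      f ▷ Y ≫ FunctorToTypes.functorHomEquiv X' Y Z k := rfl

/-- The evaluation of maps `X ⟶ Y` at a vertex of `X`. -/
noncomputable def evalVertex {X : SSet.{v}} (x : X _⦋0⦌) (Y : SSet.{v}) :
    SimplicialCategory.sHom X Y ⟶ Y :=
  lift (SSet.const x) (𝟙 _) ≫ FunctorToTypes.functorHomEquiv X _ Y (𝟙 _)

lemma evalVertex_homEquiv' {X Y : SSet.{v}} (x : X _⦋0⦌) (f : X ⟶ Y) :
    (evalVertex x Y).app _ (SimplicialCategory.homEquiv' X Y f) = f.app _ x := by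
  change f.app _ (X.map (SimplexCategory.const ⦋0⦌ ⦋0⦌ 0).op x) = f.app _ x
  congr 1
  have : SimplexCategory.const ⦋0⦌ ⦋0⦌ 0 = 𝟙 _ := by ext; simp
  simp [this]

/-- Evaluation at a vertex of `X` is a simplicial map out of `hom (X, Y)`, so it carries equal
classes of maps to equal components of `Y`. -/
lemma mapπ₀_congr {X Y : SSet.{v}} {f g : X ⟶ Y} (h : hoClass f = hoClass g) :
    SSet.mapπ₀ f = SSet.mapπ₀ g := by
  ext x
  obtain ⟨x, rfl⟩ := x.mk_surjective
  have := congrArg (SSet.mapπ₀ (evalVertex x Y)) h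
  simp only [hoClass, SSet.mapπ₀_mk] at this ⊢
  erw [evalVertex_homEquiv', evalVertex_homEquiv'] at this
  exact this

lemma IsHomotopyEquivalence.bijective_mapπ₀ {X Y : SSet.{v}} {f : X ⟶ Y}
    (hf : IsHomotopyEquivalence f) : Function.Bijective (SSet.mapπ₀ f) := by
  obtain ⟨g, h₁, h₂⟩ := hf
  have h₁ := mapπ₀_congr h₁
  have h₂ := mapπ₀_congr h₂
  refine Function.bijective_iff_has_inverse.2 ⟨SSet.mapπ₀ g, fun x => ?_, fun x => ?_⟩
  · simpa using congrFun h₁ x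
  · simpa using congrFun h₂ x

/-- The map `X m → Y m` given by an `n`-simplex of `hom (X, Y)` and a map `[m] ⟶ [n]`. -/
def sHomApp {X Y : SSet.{v}} {n : SimplexCategoryᵒᵖ} (h : (SimplicialCategory.sHom X Y).obj n)
    {m : SimplexCategoryᵒᵖ} (φ : n ⟶ m) (x : X.obj m) : Y.obj m :=
  (show (Functor.functorHom X Y).obj n from h).app m φ x

lemma sHom_ext {X Y : SSet.{v}} {n : SimplexCategoryᵒᵖ}
    {h h' : (SimplicialCategory.sHom X Y).obj n}
    (H : ∀ ⦃m : SimplexCategoryᵒᵖ⦄ (φ : n ⟶ m) (x : X.obj m), sHomApp h φ x = sHomApp h' φ x) :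
    h = h' :=
  Functor.functorHom_ext fun m φ => by
    ext x
    exact H φ x

lemma sHomApp_naturality {X Y : SSet.{v}} {n : SimplexCategoryᵒᵖ}
    (h : (SimplicialCategory.sHom X Y).obj n) {m m' : SimplexCategoryᵒᵖ} (φ : n ⟶ m)
    (ψ : m ⟶ m') (x : X.obj m) :
    sHomApp h (φ ≫ ψ) (X.map ψ x) = Y.map ψ (sHomApp h φ x) :=
  ConcreteCategory.congr_hom
    ((show (Functor.functorHom X Y).obj n from h).naturality ψ φ) x

/-- By adjunction a homotopy is an edge of `hom (X, Y)`. Its source is the face `δ 1`, which picks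
vertex `0` of `Δ[1]`; its target is the face `δ 0`, which picks vertex `1`. -/
lemma hoClass_eq_of_homotopy {X Y : SSet.{v}} (h : X ⊗ Δ[1] ⟶ Y) :
    hoClass (SSet.ι₀ ≫ h) = hoClass (SSet.ι₁ ≫ h) := by
  let k : Δ[1] ⟶ SimplicialCategory.sHom X Y := (FunctorToTypes.functorHomEquiv X Δ[1] Y).symm h
  refine SSet.π₀.sound (SSet.Edge.mk (SSet.yonedaEquiv k) ?_ ?_)
  · refine sHom_ext fun m φ x => congrArg (h.app m) (Prod.ext rfl ?_)
    refine SSet.stdSimplex.objEquiv.injective (SimplexCategory.Hom.ext _ _ (OrderHom.ext _ _ (funext fun k => ?_)))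
    change (SimplexCategory.δ 1) (φ.unop k) = 0
    rw [show φ.unop k = (0 : Fin 1) from Subsingleton.elim (α := Fin 1) _ _]
    rfl
  · refine sHom_ext fun m φ x => congrArg (h.app m) (Prod.ext rfl ?_)
    refine SSet.stdSimplex.objEquiv.injective (SimplexCategory.Hom.ext _ _ (OrderHom.ext _ _ (funext fun k => ?_)))
    change (SimplexCategory.δ 0) (φ.unop k) = 1
    rw [show φ.unop k = (0 : Fin 1) from Subsingleton.elim (α := Fin 1) _ _]
    rfl

end

/-! ### Mapping out of anodyne extensions -/

section

open SSet.modelCategoryQuillen HomotopicalAlgebra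

lemma exists_extension {X H A : SSet.{v}} {i : X ⟶ H} (hi : SSet.anodyneExtensions i)
    [SSet.KanComplex A] (f : X ⟶ A) : ∃ g : H ⟶ A, i ≫ g = f := by
  have : HasLiftingProperty i (terminal.from A) := hi _ (mem_fibrations _)
  have sq : CommSq f i (terminal.from A) (terminal.from _) := ⟨by simp⟩
  exact ⟨sq.lift, by simp⟩

/-- The map `X ⊗ ∂Δ[1] ⟶ Y` which is `a` on the vertex `0` and `b` on the vertex `1`. -/
def boundaryDesc {X Y : SSet.{v}} (a b : X ⟶ Y) : X ⊗ (∂Δ[1] : SSet.{v}) ⟶ Y where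
  app m := TypeCat.ofHom fun p =>
    if SSet.stdSimplex.objEquiv p.2.1 0 = (0 : Fin 2) then a.app m p.1 else b.app m p.1
  naturality m m' f := by
    ext ⟨x, t⟩
    -- A simplex of `∂Δ[1]` is a non-surjective map to `[1]`, hence constant, so its value at `0` is
    -- unchanged by simplicial operators.
    have ht : SSet.stdSimplex.objEquiv ((∂Δ[1] : SSet.{v}).map f t).1 0 =
        SSet.stdSimplex.objEquiv t.1 0 := by
      obtain ⟨t, ht⟩ := t
      simp only [SSet.boundary, Set.mem_ofPred_eq, Function.Surjective, not_forall, not_exists] at ht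
      obtain ⟨j, hj⟩ := ht
      have hj₁ := hj (f.unop 0)
      have hj₂ := hj 0
      change SSet.stdSimplex.objEquiv t (f.unop 0) = _
      change ¬ SSet.stdSimplex.objEquiv t (f.unop 0) = j at hj₁
      change ¬ SSet.stdSimplex.objEquiv t 0 = j at hj₂
      generalize SSet.stdSimplex.objEquiv t (f.unop 0) = y at *
      generalize SSet.stdSimplex.objEquiv t 0 = z at *
      change Fin 2 at j y z
      change y = z
      grind
    change (if SSet.stdSimplex.objEquiv ((∂Δ[1] : SSet.{v}).map f t).1 0 = (0 : Fin 2) then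
        a.app m' (X.map f x) else b.app m' (X.map f x)) =
      Y.map f (if SSet.stdSimplex.objEquiv t.1 0 = (0 : Fin 2) then a.app m x else b.app m x)
    rw [ht]
    split_ifs <;> exact NatTrans.naturality_apply _ _ _

/-- The pushout-product of `i` with `∂Δ[1] ⟶ Δ[1]` is anodyne. The maps `a`, `b` at the two ends of
`H ⊗ Δ[1]` and the constant homotopy on `X ⊗ Δ[1]` glue, and the result extends because `A` is Kan.
-/
lemma exists_homotopy {X H A : SSet.{v}} {i : X ⟶ H} (hi : SSet.anodyneExtensions i)
    [SSet.KanComplex A] (a b : H ⟶ A) (h : i ≫ a = i ≫ b) :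
    ∃ k : H ⊗ Δ[1] ⟶ A, SSet.ι₀ ≫ k = a ∧ SSet.ι₁ ≫ k = b := by
  let sq := Functor.PushoutObjObj.ofHasPushout (curriedTensor SSet.{v}) i (∂Δ[1] : SSet.Subcomplex.{v} _).ι
  have hsq := SSet.anodyneExtensions_pushoutObjObjι' sq hi
  have w : i ▷ (∂Δ[1] : SSet.{v}) ≫ boundaryDesc a b =
      X ◁ (∂Δ[1] : SSet.Subcomplex.{v} _).ι ≫ fst _ _ ≫ i ≫ a := by
    ext m ⟨x, t⟩
    change (if _ then a.app m (i.app m x) else b.app m (i.app m x)) = a.app m (i.app m x)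
    have := ConcreteCategory.congr_hom (NatTrans.congr_app h m) x
    change a.app m (i.app m x) = b.app m (i.app m x) at this
    rw [this, ite_self]
  obtain ⟨k, hk⟩ := exists_extension hsq (sq.isPushout.desc _ _ w)
  have hk' : H ◁ (∂Δ[1] : SSet.Subcomplex.{v} _).ι ≫ k = boundaryDesc a b := by
    have h₁ := sq.inl_ι
    have h₂ := sq.isPushout.inl_desc _ _ w
    rw [← hk, ← Category.assoc, h₁] at h₂
    exact h₂
  -- Simplices constant at the vertex `e` lie in the boundary because they miss the other vertex
  -- `e.rev`.
  have key (m : SimplexCategoryᵒᵖ) (x : H.obj m) (e : Fin 2) :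
      (SSet.const (SSet.stdSimplex.obj₀Equiv.{v}.symm e) : H ⟶ Δ[1]).app m x ∈
        (∂Δ[1] : SSet.Subcomplex.{v} _).obj m := by
    intro h
    obtain ⟨y, hy⟩ := h e.rev
    change e = e.rev at hy
    fin_cases e <;> simp at hy
  let p (m : SimplexCategoryᵒᵖ) (x : H.obj m) (e : Fin 2) : (H ⊗ (∂Δ[1] : SSet.{v})).obj m :=
    (x, show (∂Δ[1] : SSet.{v}).obj m from ⟨_, key m x e⟩)
  refine ⟨k, ?_, ?_⟩
  · ext m x
    exact ConcreteCategory.congr_hom (NatTrans.congr_app hk' m) (p m x 0)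
  · ext m x
    exact ConcreteCategory.congr_hom (NatTrans.congr_app hk' m) (p m x 1)

/-- Restriction along an anodyne extension is a homotopy equivalence on mapping spaces into
Kan complexes. -/
lemma isHomotopyEquivalence_eHomWhiskerRight {X H : SSet.{v}} {i : X ⟶ H}
    (hi : SSet.anodyneExtensions i) (A : SSet.{v}) [SSet.KanComplex A] :
    IsHomotopyEquivalence (eHomWhiskerRight SSet i A) := by
  let e (Y Z : SSet.{v}) := FunctorToTypes.functorHomEquiv Y Z A
  -- Extending the evaluation `X ⊗ hom (X, A) ⟶ A` along the anodyne map `i ▷ hom (X, A)` gives a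
  -- strict section `t` of the restriction map.
  obtain ⟨s, hs⟩ := exists_extension (hi.whiskerRight (SimplicialCategory.sHom X A))
    (e X (SimplicialCategory.sHom X A) (𝟙 _))
  let t : SimplicialCategory.sHom X A ⟶ SimplicialCategory.sHom H A := (e _ _).symm s
  have ht : t ≫ eHomWhiskerRight SSet i A = 𝟙 _ := by
    apply (e _ _).injective
    rw [functorHomEquiv_eHomWhiskerRight]
    refine Eq.trans ?_ hs
    exact congrArg _ ((e _ _).apply_symm_apply s)
  refine ⟨t, ?_, by rw [ht]⟩
  -- Restricting and then applying `t` agrees with the identity after restriction to `X`, as `t` is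
  -- a section; maps agreeing there are homotopic.
  obtain ⟨k, hk₀, hk₁⟩ := exists_homotopy (hi.whiskerRight (SimplicialCategory.sHom H A))
    (e _ _ (eHomWhiskerRight SSet i A ≫ t)) (e _ _ (𝟙 (SimplicialCategory.sHom H A))) (by
      rw [← functorHomEquiv_eHomWhiskerRight, ← functorHomEquiv_eHomWhiskerRight,
        Category.assoc, ht, Category.comp_id, Category.id_comp])
  let K : SimplicialCategory.sHom H A ⊗ Δ[1] ⟶ SimplicialCategory.sHom H A :=
    (e _ _).symm ((α_ _ _ _).inv ≫ k)
  have hK₀ : SSet.ι₀ ≫ K = eHomWhiskerRight SSet i A ≫ t := by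
    apply (e _ _).injective
    rw [← hk₀, functorHomEquiv_comp_left]
    rw [show FunctorToTypes.functorHomEquiv H _ A K = (α_ _ _ _).inv ≫ k from
      (e _ _).apply_symm_apply _]
    rfl
  have hK₁ : SSet.ι₁ ≫ K = 𝟙 _ := by
    apply (e _ _).injective
    rw [← hk₁, functorHomEquiv_comp_left]
    rw [show FunctorToTypes.functorHomEquiv H _ A K = (α_ _ _ _).inv ≫ k from
      (e _ _).apply_symm_apply _]
    rfl
  rw [← hK₀, ← hK₁, hoClass_eq_of_homotopy]

/-- Factor the map to the terminal object as an anodyne extension followed by a fibration. -/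
lemma exists_anodyne_kanComplex (X : SSet.{v}) :
    ∃ (H : SSet.{v}) (i : X ⟶ H), SSet.anodyneExtensions i ∧ SSet.KanComplex H := by
  let d := MorphismProperty.factorizationData SSet.modelCategoryQuillen.J.{v}.rlp.llp
    SSet.modelCategoryQuillen.J.{v}.rlp (terminal.from X)
  refine ⟨d.Z, d.i, d.hi, ?_⟩
  rw [SSet.KanComplex, isFibrant_iff_of_isTerminal d.p terminalIsTerminal, fibration_iff]
  exact d.hp

lemma kanComplex_sHom (X A : SSet.{v}) [SSet.KanComplex A] :
    SSet.KanComplex (SimplicialCategory.sHom X A) :=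
  inferInstanceAs (SSet.KanComplex ((ihom X).obj A))

instance isClosedUnderLimitsOfShape_kanComplex (ι : Type*) :
    ObjectProperty.IsClosedUnderLimitsOfShape (fun X : SSet.{v} => SSet.KanComplex X)
      (Discrete ι) where
  limitsOfShape_le := by
    rintro X ⟨h⟩
    rw [SSet.KanComplex, isFibrant_iff, fibration_iff]
    intro S T i hi
    refine ⟨fun {t b} sq => ?_⟩
    have ext (j : Discrete ι) : ∃ g : T ⟶ h.diag.obj j, i ≫ g = t ≫ h.π.app j :=
      have := h.prop_diag_obj j
      exists_extension (MorphismProperty.le_llp_rlp _ _ hi) _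
    choose g hg using ext
    exact ⟨⟨⟨h.isLimit.lift ⟨T, Discrete.natTrans g⟩,
      h.isLimit.hom_ext fun j => by
        rw [Category.assoc, h.isLimit.fac]
        exact hg j, Subsingleton.elim _ _⟩⟩⟩

lemma kanComplex_tensor (X Y : SSet.{v}) [hX : SSet.KanComplex X] [hY : SSet.KanComplex Y] :
    SSet.KanComplex (X ⊗ Y) :=
  ObjectProperty.prop_of_isLimit_binaryFan (fun X : SSet.{v} => SSet.KanComplex X)
    (tensorProductIsBinaryProduct X Y) hX hY

end

/-! ### The simplicial category of Kan complexes -/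

section

lemma isFibrantSimplicialCategory_sp : IsFibrantSimplicialCategory Sp.{v} := fun A B =>
  have := B.property
  kanComplex_sHom A.obj B.obj

/-- In `Sp`, the enriched coyoneda functors are computed by the internal hom of `SSet`. -/
noncomputable def eCoyonedaSpIso (X : Sp.{v}) :
    eCoyoneda SSet.{v} X ≅ ObjectProperty.ι _ ⋙ ihom X.obj :=
  NatIso.ofComponents (fun _ => Iso.refl _) fun _ => rfl

/-- Kan complexes are closed under products in `SSet`. These products are conical because `hom (X,
-)` is computed by an internal hom, which is a right adjoint. -/
lemma hasBinaryProducts_sp :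
    Enriched.HasConicalLimitsOfShape (Discrete WalkingPair) SSet.{v} Sp.{v} where
  hasConicalLimit _ :=
    { toHasLimit := inferInstance
      preservesLimit_eCoyoneda := fun X => preservesLimit_of_natIso _ (eCoyonedaSpIso X).symm }

end

/-! ### Comparison maps from weighted cocones -/

section

variable {K : Type u} [Category.{v} K] [SimplicialCategory K] {J : Type v} [SmallCategory J]

lemma lift_eComp_assoc {T : SSet.{v}} {W X Y Z : K} (a : T ⟶ SimplicialCategory.sHom W X)
    (b : T ⟶ SimplicialCategory.sHom X Y) (c : T ⟶ SimplicialCategory.sHom Y Z) :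
    lift a (lift b c ≫ eComp SSet X Y Z) ≫ eComp SSet W X Z =
      lift (lift a b ≫ eComp SSet W X Y) c ≫ eComp SSet W Y Z := by
  have h := congrArg (fun k => lift (lift a b) c ≫ (α_ _ _ _).hom ≫ k) (e_assoc SSet W X Y Z)
  simp only [Iso.hom_inv_id_assoc, lift_whiskerRight_assoc, lift_lift_associator_hom_assoc,
    lift_whiskerLeft_assoc] at h
  exact h.symm

lemma holimAction_assoc (D : J ⥤ K) (A B C : K) {n : SimplexCategoryᵒᵖ}
    (p : (holimS (homDiagram D A)).obj n) (y : (SimplicialCategory.sHom A B).obj n)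
    (z : (SimplicialCategory.sHom B C).obj n) :
    (holimAction D A C).app n (p, (SimplicialCategory.sHomComp A B C).app n (y, z)) =
      (holimAction D B C).app n ((holimAction D A B).app n (p, y), z) := by
  apply NatTrans.ext
  funext j
  have h : SSet.yonedaEquiv.symm ((SimplicialCategory.sHomComp A B C).app n (y, z)) =
      lift (SSet.yonedaEquiv.symm y) (SSet.yonedaEquiv.symm z) ≫ eComp SSet A B C :=
    (SSet.yonedaEquiv_symm_comp (X := SimplicialCategory.sHom A B ⊗ SimplicialCategory.sHom B C)
      (n := n.unop) (y, z) (eComp SSet A B C)).symm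
  refine (congrArg (fun k => lift (p.app j) (snd _ _ ≫ k) ≫ eComp SSet (D.obj j.unop) A C) h).trans
    (Eq.trans ?_ (lift_eComp_assoc (p.app j) (snd _ _ ≫ SSet.yonedaEquiv.symm y)
      (snd _ _ ≫ SSet.yonedaEquiv.symm z)))
  refine congrArg (fun k => lift (p.app j) k ≫ eComp SSet (D.obj j.unop) A C) ?_
  exact (Category.assoc _ _ _).symm.trans (congrArg (fun k => k ≫ eComp SSet A B C)
    (comp_lift _ _ _))

/-- The constant map to a weighted limit given by a natural transformation. -/
def constWeightedLimit (X : SSet.{v}) {W F : J ⥤ SSet.{v}} (c : W ⟶ F) :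
    X ⟶ weightedLimit W F where
  app n := TypeCat.ofHom fun _ => fst W _ ≫ c

/-- The comparison map `hom (H, A) ⟶ holim hom (D, A)` given by a weighted cocone with tip `H`. -/
noncomputable def cocomparison {D : J ⥤ K} {H : K} (c : holimWeight Jᵒᵖ ⟶ homDiagram D H) (A : K) :
    SimplicialCategory.sHom H A ⟶ holimS (homDiagram D A) :=
  lift (constWeightedLimit _ c) (𝟙 _) ≫ holimAction D H A

/-- The comparison map is the action on a fixed cocone, so its simplicial naturality is the
associativity of that action. -/
lemma cocomparison_natural {D : J ⥤ K} {H : K} (c : holimWeight Jᵒᵖ ⟶ homDiagram D H) (A A' : K) :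
    SimplicialCategory.sHomComp H A A' ≫ cocomparison c A' =
      cocomparison c A ▷ SimplicialCategory.sHom A A' ≫ holimAction D A A' := by
  refine NatTrans.ext (funext fun n => ConcreteCategory.hom_ext _ _ fun p => ?_)
  exact holimAction_assoc D H A A' ((constWeightedLimit (SimplicialCategory.sHom H A) c).app n p.1)
    p.1 p.2

end

/-! ### The simplicial homotopy colimit of a diagram of simplicial sets -/

section

variable {J : Type v} [SmallCategory J]

/-- The action of a morphism of `Jᵒᵖ` on the simplices of the values of a diagram. -/
def pull (F : J ⥤ SSet.{v}) {j j' : Jᵒᵖ} (g : j ⟶ j') {m : SimplexCategoryᵒᵖ}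
    (x : (F.obj j'.unop).obj m) : (F.obj j.unop).obj m :=
  (F.map g.unop).app m x

lemma pull_id (F : J ⥤ SSet.{v}) {j : Jᵒᵖ} {m : SimplexCategoryᵒᵖ} (x : (F.obj j.unop).obj m) :
    pull F (𝟙 j) x = x := by
  simp [pull]

lemma pull_comp (F : J ⥤ SSet.{v}) {j j' j'' : Jᵒᵖ} (g : j ⟶ j') (g' : j' ⟶ j'')
    {m : SimplexCategoryᵒᵖ} (x : (F.obj j''.unop).obj m) :
    pull F (g ≫ g') x = pull F g (pull F g' x) := by
  simp [pull]

lemma map_pull (F : J ⥤ SSet.{v}) {j j' : Jᵒᵖ} (g : j ⟶ j') {m m' : SimplexCategoryᵒᵖ}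
    (f : m ⟶ m') (x : (F.obj j'.unop).obj m) :
    (F.obj j.unop).map f (pull F g x) = pull F g ((F.obj j'.unop).map f x) :=
  (NatTrans.naturality_apply (F.map g.unop) f x).symm

/-- The last vertex of a simplex of a nerve. -/
abbrev lastVertex {C : Type*} [Category* C] {m : SimplexCategoryᵒᵖ}
    (σ : ComposableArrows C m.unop.len) : C :=
  σ.obj (Fin.last m.unop.len)

/-- The morphism between the last vertices of a face `f^* σ` and of `σ`. -/
abbrev toLastVertex {C : Type*} [Category* C] {m m' : SimplexCategoryᵒᵖ}
    (σ : ComposableArrows C m.unop.len) (f : m ⟶ m') :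
    σ.obj (f.unop (Fin.last m'.unop.len)) ⟶ lastVertex σ :=
  σ.map (homOfLE (Fin.le_last _))

lemma toLastVertex_id {C : Type*} [Category* C] {m : SimplexCategoryᵒᵖ}
    (σ : ComposableArrows C m.unop.len) : toLastVertex σ (𝟙 m) = 𝟙 (lastVertex σ) :=
  σ.map_id _

lemma toLastVertex_comp {C : Type u} [Category.{v} C] {m m' m'' : SimplexCategoryᵒᵖ}
    (σ : ComposableArrows C m.unop.len) (f : m ⟶ m') (g : m' ⟶ m'') :
    toLastVertex σ (f ≫ g) =
      toLastVertex (m := m') ((nerve C).map f σ) g ≫ toLastVertex σ f :=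
  σ.map_comp (homOfLE (f.unop.toOrderHom.monotone (Fin.le_last _))) (homOfLE (Fin.le_last _))

/-- The simplicial homotopy colimit (bar construction) of a diagram of simplicial sets: an
`m`-simplex consists of a chain of length `m` in `Jᵒᵖ` and an `m`-simplex of the value of the
diagram at the last vertex of the chain. -/
def hocolimS (F : J ⥤ SSet.{v}) : SSet.{v} where
  obj m := Σ σ : ComposableArrows Jᵒᵖ m.unop.len, (F.obj (lastVertex σ).unop).obj m
  map f := TypeCat.ofHom fun s => ⟨(nerve Jᵒᵖ).map f s.1,
    pull F (toLastVertex s.1 f) ((F.obj _).map f s.2)⟩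
  map_id m := by
    refine ConcreteCategory.hom_ext _ _ fun ⟨σ, x⟩ => congrArg (Sigma.mk σ) ?_
    refine (congrArg₂ (fun g y => pull F g y) (toLastVertex_id σ)
      (Functor.map_id_apply (F.obj _) _ x)).trans (pull_id F x)
  map_comp {m m' m''} f g := by
    refine ConcreteCategory.hom_ext _ _ fun ⟨σ, x⟩ =>
      congrArg (Sigma.mk ((nerve Jᵒᵖ).map (f ≫ g) σ)) ?_
    refine (congrArg₂ (fun g y => pull F g y) (toLastVertex_comp σ f g)
      (Functor.map_comp_apply (F.obj _) f g x)).trans ?_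
    refine (pull_comp F _ _ _).trans (congrArg _ ?_)
    exact (map_pull F _ _ _).symm

/-- The simplex of the simplicial homotopy colimit given by a chain in `Jᵒᵖ`, a morphism from its
last vertex to `j` and a simplex of the value at `j`. -/
def hocolimS.mk (F : J ⥤ SSet.{v}) {m : SimplexCategoryᵒᵖ} (σ : ComposableArrows Jᵒᵖ m.unop.len)
    {j : Jᵒᵖ} (g : lastVertex σ ⟶ j) (x : (F.obj j.unop).obj m) : (hocolimS F).obj m :=
  ⟨σ, pull F g x⟩

lemma hocolimS.map_mk (F : J ⥤ SSet.{v}) {m m' : SimplexCategoryᵒᵖ} (f : m ⟶ m')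
    (σ : ComposableArrows Jᵒᵖ m.unop.len) {j : Jᵒᵖ} (g : lastVertex σ ⟶ j)
    (x : (F.obj j.unop).obj m) :
    (hocolimS F).map f (hocolimS.mk F σ g x) =
      hocolimS.mk F (m := m') ((nerve Jᵒᵖ).map f σ) (toLastVertex σ f ≫ g)
        ((F.obj j.unop).map f x) := by
  refine congrArg (Sigma.mk ((nerve Jᵒᵖ).map f σ)) ?_
  exact (congrArg _ (map_pull F g f x)).trans (pull_comp F _ _ _).symm

/-- This is the coend relation: it makes the maps `hocolimS.ι` form a weighted cocone. -/
lemma hocolimS.mk_comp (F : J ⥤ SSet.{v}) {m : SimplexCategoryᵒᵖ}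
    (σ : ComposableArrows Jᵒᵖ m.unop.len) {j j' : Jᵒᵖ} (g : lastVertex σ ⟶ j) (g' : j ⟶ j')
    (x : (F.obj j'.unop).obj m) :
    hocolimS.mk F σ (g ≫ g') x = hocolimS.mk F σ g (pull F g' x) :=
  congrArg (Sigma.mk σ) (pull_comp F g g' x)

lemma hocolimS.mk_id (F : J ⥤ SSet.{v}) {m : SimplexCategoryᵒᵖ}
    (σ : ComposableArrows Jᵒᵖ m.unop.len) (x : (F.obj (lastVertex σ).unop).obj m) :
    hocolimS.mk F σ (𝟙 _) x = (show (hocolimS F).obj m from Sigma.mk σ x) :=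
  congrArg (Sigma.mk σ) (pull_id F x)

/-- The canonical map from the product of `F j` with the nerve of the category of objects
over `j` to the simplicial homotopy colimit of `F`. -/
def hocolimS.ι (F : J ⥤ SSet.{v}) (j : Jᵒᵖ) :
    F.obj j.unop ⊗ (holimWeight Jᵒᵖ).obj j ⟶ hocolimS F where
  app m := TypeCat.ofHom fun (p : (F.obj j.unop).obj m × ComposableArrows (Over j) m.unop.len) =>
    hocolimS.mk F (m := m) (p.2 ⋙ Over.forget j) (lastVertex p.2).hom p.1
  naturality m m' f := by
    refine ConcreteCategory.hom_ext _ _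
      fun (p : (F.obj j.unop).obj m × ComposableArrows (Over j) m.unop.len) => ?_
    refine Eq.trans ?_ (hocolimS.map_mk F f _ _ _).symm
    exact congrArg (fun g => hocolimS.mk F (m := m') _ g ((F.obj j.unop).map f p.1))
      (Over.w (toLastVertex p.2 f)).symm

/-- The universal weighted cocone on the simplicial homotopy colimit. -/
def hocolimCocone (F : J ⥤ SSet.{v}) : holimWeight Jᵒᵖ ⟶ homDiagram F (hocolimS F) where
  app j := (FunctorToTypes.functorHomEquiv (F.obj j.unop) _ _).symm (hocolimS.ι F j)
  naturality j j' g := by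
    refine NatTrans.ext (funext fun m => ConcreteCategory.hom_ext _ _ fun τ => ?_)
    refine sHom_ext fun m' φ x => ?_
    exact hocolimS.mk_comp F _ _ _ _

end

/-! ### The universal property of the simplicial homotopy colimit -/

section

/-- A chain, considered as a chain of objects over its last vertex. -/
def overChain {C : Type*} [Category* C] {m : SimplexCategoryᵒᵖ}
    (σ : ComposableArrows C m.unop.len) : ComposableArrows (Over (lastVertex σ)) m.unop.len where
  obj i := Over.mk (σ.map (homOfLE (Fin.le_last i)))
  map f := Over.homMk (σ.map f) (σ.map_comp _ _).symm
  map_id _ := by ext; exact σ.map_id _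
  map_comp _ _ := by ext; exact σ.map_comp _ _

/-- A chain over `j` amounts to its underlying chain and the structure map of its last object. Thus
elements of the weight reduce to canonical chains `overChain σ`, which is why the coend has the
normal form used in `hocolimS`. -/
lemma overChain_comp_map {C : Type*} [Category* C] {j : C} {m : SimplexCategoryᵒᵖ}
    (τ : ComposableArrows (Over j) m.unop.len) :
    overChain (τ ⋙ Over.forget j) ⋙ Over.map (lastVertex τ).hom = τ := by
  have h (i : Fin (m.unop.len + 1)) :
      (overChain (τ ⋙ Over.forget j) ⋙ Over.map (lastVertex τ).hom).obj i = τ.obj i :=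
    congrArg Over.mk (Over.w (τ.map (homOfLE (Fin.le_last i))))
  refine CategoryTheory.Functor.ext h fun i i' f => ?_
  ext
  rw [Over.comp_left, Over.comp_left, Over.eqToHom_left, Over.eqToHom_left]
  exact ((Category.id_comp _).trans (Category.comp_id _)).symm

variable {J : Type v} [SmallCategory J] (F : J ⥤ SSet.{v}) {A : SSet.{v}}

/-- The value of a simplex of the simplicial homotopy limit of `hom (F, A)` on a chain over `j`. -/
def holimApp {F : J ⥤ SSet.{v}} {n : SimplexCategoryᵒᵖ} (p : (holimS (homDiagram F A)).obj n)
    {j : Jᵒᵖ} {m : SimplexCategoryᵒᵖ} (τ : ComposableArrows (Over j) m.unop.len) (t : n ⟶ m) :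
    (SimplicialCategory.sHom (F.obj j.unop) A).obj m :=
  (p.app j).app m (τ, SSet.stdSimplex.objEquiv.symm t.unop)

section

variable {F} {n : SimplexCategoryᵒᵖ} (p : (holimS (homDiagram F A)).obj n)

lemma holimApp_ext {p q : (holimS (homDiagram F A)).obj n}
    (h : ∀ (j : Jᵒᵖ) (m : SimplexCategoryᵒᵖ) (τ : ComposableArrows (Over j) m.unop.len)
      (t : n ⟶ m), holimApp p τ t = holimApp q τ t) : p = q :=
  NatTrans.ext (funext fun j => NatTrans.ext (funext fun m =>
    ConcreteCategory.hom_ext _ _ fun ⟨τ, t⟩ => h j m τ (SSet.stdSimplex.objEquiv t).op))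

lemma sHomApp_holimApp_map {j : Jᵒᵖ} {m m' m'' : SimplexCategoryᵒᵖ}
    (τ : ComposableArrows (Over j) m.unop.len) (t : n ⟶ m) (f : m ⟶ m') (φ : m' ⟶ m'')
    (x : (F.obj j.unop).obj m'') :
    sHomApp (holimApp (m := m') p ((nerve (Over j)).map f τ) (t ≫ f)) φ x =
      sHomApp (holimApp p τ t) (f ≫ φ) x := by
  let a : ((holimWeight Jᵒᵖ ⊗ (Functor.const Jᵒᵖ).obj (SSet.stdSimplex.obj n.unop)).obj j).obj m :=
    (τ, SSet.stdSimplex.objEquiv.symm t.unop)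
  exact congrArg (fun k => sHomApp k φ x) (NatTrans.naturality_apply (p.app j) f a)

lemma sHomApp_holimApp_comp_map {j j' : Jᵒᵖ} (g : j ⟶ j') {m m' : SimplexCategoryᵒᵖ}
    (τ : ComposableArrows (Over j) m.unop.len) (t : n ⟶ m) (φ : m ⟶ m')
    (x : (F.obj j'.unop).obj m') :
    sHomApp (holimApp p (τ ⋙ Over.map g) t) φ x = sHomApp (holimApp p τ t) φ (pull F g x) := by
  let a : ((holimWeight Jᵒᵖ ⊗ (Functor.const Jᵒᵖ).obj (SSet.stdSimplex.obj n.unop)).obj j).obj m :=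
    (τ, SSet.stdSimplex.objEquiv.symm t.unop)
  have h := ConcreteCategory.congr_hom (NatTrans.congr_app (p.naturality g) m) a
  exact congrArg (fun k => sHomApp k φ x) h

end

/-- The value on a simplex of `hocolimS F` of the map corresponding to a simplex of the simplicial
homotopy limit of `hom (F, A)`. -/
def hocolimDescApp {n : SimplexCategoryᵒᵖ} (p : (holimS (homDiagram F A)).obj n)
    {m : SimplexCategoryᵒᵖ} (t : n ⟶ m) (s : (hocolimS F).obj m) : A.obj m :=
  sHomApp (holimApp p (overChain s.1) t) (𝟙 m) s.2

lemma hocolimDescApp_ι {n : SimplexCategoryᵒᵖ} (p : (holimS (homDiagram F A)).obj n)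
    {m : SimplexCategoryᵒᵖ} (t : n ⟶ m) {j : Jᵒᵖ} (x : (F.obj j.unop).obj m)
    (τ : ComposableArrows (Over j) m.unop.len) :
    hocolimDescApp F p t ((hocolimS.ι F j).app m (x, τ)) = sHomApp (holimApp p τ t) (𝟙 m) x := by
  have h := sHomApp_holimApp_comp_map p (lastVertex τ).hom (overChain (τ ⋙ Over.forget j)) t (𝟙 m) x
  exact h.symm.trans
    (congrArg (fun τ' => sHomApp (holimApp p τ' t) (𝟙 m) x) (overChain_comp_map τ))

lemma hocolimS.ι_overChain {m : SimplexCategoryᵒᵖ} (s : (hocolimS F).obj m) :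
    (hocolimS.ι F (lastVertex s.1)).app m (s.2, overChain s.1) = s := by
  have h : (lastVertex (overChain s.1)).hom = 𝟙 _ := s.1.map_id _
  refine (congrArg (fun g => hocolimS.mk F s.1 g s.2) h).trans ?_
  exact hocolimS.mk_id F s.1 s.2

/-- A face can change the last vertex, so a face of `overChain s.1` need not be the canonical chain
of the face. Writing `s` as a value of `hocolimS.ι` avoids this, since `hocolimDescApp_ι` accepts
arbitrary chains over `j`. -/
lemma hocolimDescApp_map {n : SimplexCategoryᵒᵖ} (p : (holimS (homDiagram F A)).obj n)
    {m m' : SimplexCategoryᵒᵖ} (t : n ⟶ m) (f : m ⟶ m') (s : (hocolimS F).obj m) :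
    hocolimDescApp F p (t ≫ f) ((hocolimS F).map f s) = A.map f (hocolimDescApp F p t s) := by
  let a : (F.obj (lastVertex s.1).unop ⊗ (holimWeight Jᵒᵖ).obj (lastVertex s.1)).obj m :=
    (s.2, overChain s.1)
  have h := NatTrans.naturality_apply (hocolimS.ι F (lastVertex s.1)) f a
  rw [hocolimS.ι_overChain] at h
  rw [← h]
  refine (hocolimDescApp_ι F p (t ≫ f) ((F.obj (lastVertex s.1).unop).map f s.2)
    ((nerve (Over (lastVertex s.1))).map f (overChain s.1))).trans ?_
  refine (sHomApp_holimApp_map p (overChain s.1) t f (𝟙 m') _).trans ?_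
  have h' := sHomApp_naturality (holimApp p (overChain s.1) t) (𝟙 m) f s.2
  rw [Category.id_comp] at h'
  rw [Category.comp_id]
  exact h'

lemma bijective_cocomparison (A : SSet.{v}) (n : SimplexCategoryᵒᵖ) :
    Function.Bijective ((cocomparison (hocolimCocone F) A).app n) := by
  -- The comparison map is precomposition with `hocolimS.ι`. Injectivity then follows because every
  -- simplex is hit by some `hocolimS.ι`, surjectivity from `hocolimDescApp`.
  have key (h : (SimplicialCategory.sHom (hocolimS F) A).obj n) (j : Jᵒᵖ)
      {m m' : SimplexCategoryᵒᵖ} (τ : ComposableArrows (Over j) m.unop.len) (t : n ⟶ m)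
      (φ : m ⟶ m') (x : (F.obj j.unop).obj m') :
      sHomApp (holimApp ((cocomparison (hocolimCocone F) A).app n h) τ t) φ x =
        sHomApp h (t ≫ φ) ((hocolimS.ι F j).app m' (x, (nerve (Over j)).map φ τ)) :=
    rfl
  constructor
  · intro h h' H
    refine sHom_ext fun m t s => ?_
    have hs (h : (SimplicialCategory.sHom (hocolimS F) A).obj n) :
        sHomApp h t s =
          sHomApp (holimApp ((cocomparison (hocolimCocone F) A).app n h) (overChain s.1) t)
            (𝟙 m) s.2 := by
      rw [key, Category.comp_id]
      exact congrArg (sHomApp h t) (hocolimS.ι_overChain F s).symm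
    exact (hs h).trans ((congrArg (fun k => sHomApp (holimApp k (overChain s.1) t) (𝟙 m) s.2)
      H).trans (hs h').symm)
  · intro p
    refine ⟨show (Functor.functorHom (hocolimS F) A).obj n from
      { app m t := TypeCat.ofHom fun s => hocolimDescApp F p t s
        naturality f t := ConcreteCategory.hom_ext _ _ fun s => hocolimDescApp_map F p t f s }, ?_⟩
    refine holimApp_ext fun j m τ t => sHom_ext fun m' φ x => ?_
    rw [key]
    refine (hocolimDescApp_ι F p (t ≫ φ) _ _).trans ?_
    rw [sHomApp_holimApp_map, Category.comp_id]

instance isIso_cocomparison (A : SSet.{v}) : IsIso (cocomparison (hocolimCocone F) A) :=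
  (NatTrans.isIso_iff_isIso_app _).2 fun n => (isIso_iff_bijective _).2
    (bijective_cocomparison F A n)

end

/-! ### Uniqueness of fibrant homotopy colimits -/

section

variable {K : Type u} [Category.{v} K] [SimplicialCategory K] {J : Type v} [SmallCategory J]
  {D : J ⥤ K}

/-- Postcomposition with `f : A ⟶ A'` on simplicial homotopy limits. -/
noncomputable def holimPostcomp (D : J ⥤ K) {A A' : K} (f : A ⟶ A') :
    holimS (homDiagram D A) ⟶ holimS (homDiagram D A') :=
  (ρ_ _).inv ≫ _ ◁ eHomEquiv SSet f ≫ holimAction D A A'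

/-- Simplicial naturality is restricted to the vertex `f` of `hom (A, A')`. -/
lemma FibrantHocolim.δ_naturality {H : K} (c : FibrantHocolim D H) {A A' : K} (f : A ⟶ A') :
    eHomWhiskerLeft SSet H f ≫ c.δ A' = c.δ A ≫ holimPostcomp D f := by
  have h := c.natural A A'
  simp only [eHomWhiskerLeft, holimPostcomp, Category.assoc]
  rw [h, whisker_exchange_assoc]
  simp

/-- Fibrant homotopy colimits of a diagram are unique up to homotopy equivalence. -/
lemma IsFibrantHocolim.homotopyEquivalent {H H' : K} (h : IsFibrantHocolim D H)
    (h' : IsFibrantHocolim D H') : HomotopyEquivalent H H' := by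
  obtain ⟨c⟩ := h
  obtain ⟨c'⟩ := h'
  have nat {A A' : K} {H : K} (c : FibrantHocolim D H) (x : H ⟶ A) (f : A ⟶ A') :
      SSet.mapπ₀ (c.δ A') (hoClass (x ≫ f)) =
        SSet.mapπ₀ (holimPostcomp D f) (SSet.mapπ₀ (c.δ A) (hoClass x)) := by
    rw [← mapπ₀_eHomWhiskerLeft_hoClass, ← SSet.mapπ₀_comp_apply, c.δ_naturality,
      SSet.mapπ₀_comp_apply]
  -- As in the Yoneda lemma, `f` is chosen to represent the universal class of `H'`; bijectivity of
  -- `δ` on `π₀` provides it.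
  have ex {H H' : K} (c : FibrantHocolim D H) (c' : FibrantHocolim D H') :
      ∃ f : H ⟶ H', SSet.mapπ₀ (c.δ H') (hoClass f) = SSet.mapπ₀ (c'.δ H') (hoClass (𝟙 H')) := by
    obtain ⟨x, hx⟩ := (c.isHomotopyEquivalence H').bijective_mapπ₀.2
      (SSet.mapπ₀ (c'.δ H') (hoClass (𝟙 H')))
    obtain ⟨f, rfl⟩ := hoClass_surjective x
    exact ⟨f, hx⟩
  have comp {H H' : K} (c : FibrantHocolim D H) (c' : FibrantHocolim D H') (f : H ⟶ H')
      (g : H' ⟶ H)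
      (hf : SSet.mapπ₀ (c.δ H') (hoClass f) = SSet.mapπ₀ (c'.δ H') (hoClass (𝟙 H')))
      (hg : SSet.mapπ₀ (c'.δ H) (hoClass g) = SSet.mapπ₀ (c.δ H) (hoClass (𝟙 H))) :
      hoClass (f ≫ g) = hoClass (𝟙 H) := by
    apply (c.isHomotopyEquivalence H).bijective_mapπ₀.1
    rw [nat, hf, ← nat, Category.id_comp, hg]
  obtain ⟨f, hf⟩ := ex c c'
  obtain ⟨g, hg⟩ := ex c' c
  exact ⟨f, g, comp c c' f g hf hg, comp c' c g f hg hf⟩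

end

/-! ### Fibrant homotopy colimits of Kan complexes -/

section

variable {J : Type v} [SmallCategory J]

/-- The weighted cocone with tip `H` induced by a map `hocolimS F ⟶ H`. -/
noncomputable def coconeOfMap (F : J ⥤ SSet.{v}) {H : SSet.{v}} (i : hocolimS F ⟶ H) :
    holimWeight Jᵒᵖ ⟶ homDiagram F H :=
  hocolimCocone F ≫ Functor.whiskerLeft F.op ((SimplicialCategory.sHomFunctor SSet.{v}).flip.map i)

lemma cocomparison_coconeOfMap (F : J ⥤ SSet.{v}) {H : SSet.{v}} (i : hocolimS F ⟶ H)
    (A : SSet.{v}) :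
    cocomparison (coconeOfMap F i) A =
      eHomWhiskerRight SSet i A ≫ cocomparison (hocolimCocone F) A := by
  refine NatTrans.ext (funext fun n => ConcreteCategory.hom_ext _ _ fun h => ?_)
  exact holimApp_ext fun j m τ t => sHom_ext fun m' φ x => rfl

/-- A Kan complex which receives an anodyne extension from the simplicial homotopy colimit of a
diagram of Kan complexes is a fibrant homotopy colimit of the diagram. -/
lemma isFibrantHocolim_of_anodyne (D : J ⥤ Sp.{v}) (H : Sp.{v})
    (i : hocolimS (D ⋙ ObjectProperty.ι _) ⟶ H.obj) (hi : SSet.anodyneExtensions i) :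
    IsFibrantHocolim D H := by
  let c : holimWeight Jᵒᵖ ⟶ homDiagram D H := coconeOfMap (D ⋙ ObjectProperty.ι _) i
  refine ⟨⟨cocomparison c, cocomparison_natural c, fun A => ?_⟩⟩
  have h := cocomparison_coconeOfMap (D ⋙ ObjectProperty.ι _) i A.obj
  -- Hom-objects of `Sp` are definitionally those of `SSet`, so the claim can be checked there.
  change IsHomotopyEquivalence (cocomparison (coconeOfMap (D ⋙ ObjectProperty.ι _) i) A.obj)
  rw [h]
  have := A.property
  exact (isHomotopyEquivalence_eHomWhiskerRight hi A.obj).comp (.of_isIso _)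

lemma hasFibrantHocolims_sp : HasFibrantHocolims Sp.{v} := fun J _ D => by
  obtain ⟨H, i, hi, hH⟩ := exists_anodyne_kanComplex (hocolimS (D ⋙ ObjectProperty.ι _))
  exact ⟨⟨H, hH⟩, isFibrantHocolim_of_anodyne D ⟨H, hH⟩ i hi⟩

end

/-! ### Products -/

section

variable {J₁ J₂ : Type v} [SmallCategory J₁] [SmallCategory J₂]

/-- The diagram `(j₁, j₂) ↦ F₁ j₁ ⊗ F₂ j₂` of simplicial sets. -/
def tensorDiagram (F₁ : J₁ ⥤ SSet.{v}) (F₂ : J₂ ⥤ SSet.{v}) : J₁ × J₂ ⥤ SSet.{v} where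
  obj j := F₁.obj j.1 ⊗ F₂.obj j.2
  map f := F₁.map f.1 ⊗ₘ F₂.map f.2

/-- The functoriality of simplicial homotopy colimits. -/
def hocolimS.map {J : Type v} [SmallCategory J] {F G : J ⥤ SSet.{v}} (α : F ⟶ G) :
    hocolimS F ⟶ hocolimS G where
  app m := TypeCat.ofHom fun s => ⟨s.1, (α.app (lastVertex s.1).unop).app m s.2⟩
  naturality m m' f := by
    refine ConcreteCategory.hom_ext _ _ fun ⟨σ, x⟩ =>
      congrArg (Sigma.mk ((nerve Jᵒᵖ).map f σ)) ?_
    have h := NatTrans.congr_app (α.naturality (toLastVertex σ f).unop) m'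
    refine (ConcreteCategory.congr_hom h ((F.obj (lastVertex σ).unop).map f x)).trans ?_
    exact congrArg (pull G (toLastVertex σ f))
      (NatTrans.naturality_apply (α.app (lastVertex σ).unop) f x)

/-- Naturally isomorphic diagrams have isomorphic simplicial homotopy colimits. -/
def hocolimS.mapIso {J : Type v} [SmallCategory J] {F G : J ⥤ SSet.{v}} (e : F ≅ G) :
    hocolimS F ≅ hocolimS G where
  hom := hocolimS.map e.hom
  inv := hocolimS.map e.inv
  hom_inv_id := by
    refine NatTrans.ext (funext fun m => ConcreteCategory.hom_ext _ _ fun ⟨σ, x⟩ =>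
      congrArg (Sigma.mk σ) ?_)
    exact ConcreteCategory.congr_hom
      (NatTrans.congr_app (e.hom_inv_id_app (lastVertex σ).unop) m) x
  inv_hom_id := by
    refine NatTrans.ext (funext fun m => ConcreteCategory.hom_ext _ _ fun ⟨σ, x⟩ =>
      congrArg (Sigma.mk σ) ?_)
    exact ConcreteCategory.congr_hom
      (NatTrans.congr_app (e.inv_hom_id_app (lastVertex σ).unop) m) x

/-- Simplicial homotopy colimits commute with binary products. -/
def hocolimTensorIso (F₁ : J₁ ⥤ SSet.{v}) (F₂ : J₂ ⥤ SSet.{v}) :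
    hocolimS (tensorDiagram F₁ F₂) ≅ hocolimS F₁ ⊗ hocolimS F₂ where
  hom :=
    -- A chain in a product category is a pair of chains of the same length, and its last vertex is
    -- the pair of last vertices.
    { app m := TypeCat.ofHom fun (s : Σ σ : ComposableArrows (J₁ × J₂)ᵒᵖ m.unop.len,
          (F₁.obj (lastVertex σ).unop.1).obj m × (F₂.obj (lastVertex σ).unop.2).obj m) =>
        (⟨s.1 ⋙ (CategoryTheory.Prod.fst J₁ J₂).op, s.2.1⟩,
          ⟨s.1 ⋙ (CategoryTheory.Prod.snd J₁ J₂).op, s.2.2⟩)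
      naturality m m' f := rfl }
  inv :=
    { app m := TypeCat.ofHom fun (s : (Σ σ : ComposableArrows J₁ᵒᵖ m.unop.len,
            (F₁.obj (lastVertex σ).unop).obj m) × (Σ σ : ComposableArrows J₂ᵒᵖ m.unop.len,
            (F₂.obj (lastVertex σ).unop).obj m)) =>
        ⟨{ obj k := op (⟨(s.1.1.obj k).unop, (s.2.1.obj k).unop⟩ : J₁ × J₂)
           map f := Quiver.Hom.op (⟨(s.1.1.map f).unop, (s.2.1.map f).unop⟩ :
            (⟨_, _⟩ : J₁ × J₂) ⟶ ⟨_, _⟩)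
           map_id k := by rw [s.1.1.map_id, s.2.1.map_id]; rfl
           map_comp f g := by rw [s.1.1.map_comp, s.2.1.map_comp]; rfl }, ⟨s.1.2, s.2.2⟩⟩
      naturality m m' f := rfl }
  hom_inv_id := rfl
  inv_hom_id := rfl

/-- Binary products in `Sp` are products of simplicial sets. -/
noncomputable def prodSpIso [HasBinaryProducts Sp.{v}] (A B : Sp.{v}) :
    (A ⨯ B).obj ≅ A.obj ⊗ B.obj :=
  have := A.property
  have := B.property
  let P : Sp.{v} := ⟨A.obj ⊗ B.obj, kanComplex_tensor A.obj B.obj⟩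
  let a : P ⟶ A := ObjectProperty.homMk (fst A.obj B.obj)
  let b : P ⟶ B := ObjectProperty.homMk (snd A.obj B.obj)
  let q : P ⟶ A ⨯ B := prod.lift a b
  have q_fst : q.hom ≫ (prod.fst : A ⨯ B ⟶ A).hom = fst A.obj B.obj :=
    congrArg InducedCategory.Hom.hom (prod.lift_fst a b)
  have q_snd : q.hom ≫ (prod.snd : A ⨯ B ⟶ B).hom = snd A.obj B.obj :=
    congrArg InducedCategory.Hom.hom (prod.lift_snd a b)
  { hom := lift (prod.fst : A ⨯ B ⟶ A).hom (prod.snd : A ⨯ B ⟶ B).hom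
    inv := q.hom
    hom_inv_id := by
      let p : A ⨯ B ⟶ P :=
        ObjectProperty.homMk (lift (prod.fst : A ⨯ B ⟶ A).hom (prod.snd : A ⨯ B ⟶ B).hom)
      have h : p ≫ q = 𝟙 _ := by
        apply Limits.prod.hom_ext
        · rw [Category.assoc, prod.lift_fst, Category.id_comp]
          rfl
        · rw [Category.assoc, prod.lift_snd, Category.id_comp]
          rfl
      exact congrArg InducedCategory.Hom.hom h
    inv_hom_id := by
      rw [comp_lift, q_fst, q_snd, lift_fst_snd] }

/-- The diagram of the products in `Sp`, considered in simplicial sets. -/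
noncomputable def prodDiagramIso [HasBinaryProducts Sp.{v}] (D₁ : J₁ ⥤ Sp.{v}) (D₂ : J₂ ⥤ Sp.{v}) :
    prodDiagram D₁ D₂ ⋙ ObjectProperty.ι _ ≅
      tensorDiagram (D₁ ⋙ ObjectProperty.ι _) (D₂ ⋙ ObjectProperty.ι _) :=
  NatIso.ofComponents (fun j => prodSpIso _ _) fun {j j'} f => by
    have h₁ := congrArg InducedCategory.Hom.hom (prod.map_fst (D₁.map f.1) (D₂.map f.2))
    have h₂ := congrArg InducedCategory.Hom.hom (prod.map_snd (D₁.map f.1) (D₂.map f.2))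
    refine (comp_lift (C := SSet.{v}) _ _ _).trans
      (Eq.trans ?_ (lift_map (C := SSet.{v}) _ _ _ _).symm)
    exact congrArg₂ (fun x y => lift (C := SSet.{v}) x y) h₁ h₂

/-- The map `hom (A, A') ⟶ hom (A ⊗ B, A' ⊗ B)` given by the product with `B`. -/
noncomputable def sHomTensorRight (A A' B : SSet.{v}) :
    SimplicialCategory.sHom A A' ⟶ SimplicialCategory.sHom (A ⊗ B) (A' ⊗ B) :=
  (FunctorToTypes.functorHomEquiv (A ⊗ B) (SimplicialCategory.sHom A A') (A' ⊗ B)).symm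
    (lift (fst A B ▷ _ ≫ FunctorToTypes.functorHomEquiv A _ A' (𝟙 _)) (fst _ _ ≫ snd A B))

/-- The product with `B` acts on mapping spaces by a simplicial map, hence on their components. -/
lemma hoClass_whiskerRight {A A' : SSet.{v}} {f g : A ⟶ A'} (h : hoClass f = hoClass g)
    (B : SSet.{v}) : hoClass (f ▷ B) = hoClass (g ▷ B) := by
  have key (f : A ⟶ A') : hoClass (f ▷ B) = SSet.mapπ₀ (sHomTensorRight A A' B) (hoClass f) := rfl
  rw [key, key, h]

lemma HomotopyEquivalent.tensor_right {A A' : SSet.{v}} (h : HomotopyEquivalent A A')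
    (B : SSet.{v}) : HomotopyEquivalent (A ⊗ B) (A' ⊗ B) := by
  obtain ⟨f, g, hfg, hgf⟩ := h
  refine ⟨f ▷ B, g ▷ B, ?_, ?_⟩
  · rw [← comp_whiskerRight, hoClass_whiskerRight hfg, id_whiskerRight]
  · rw [← comp_whiskerRight, hoClass_whiskerRight hgf, id_whiskerRight]

lemma HomotopyEquivalent.tensor {A A' B B' : SSet.{v}} (h : HomotopyEquivalent A A')
    (h' : HomotopyEquivalent B B') : HomotopyEquivalent (A ⊗ B) (A' ⊗ B') :=
  (h.tensor_right B).trans ((HomotopyEquivalent.of_iso (β_ A' B)).trans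
    ((h'.tensor_right A').trans (.of_iso (β_ B' A'))))

lemma homotopyEquivalent_sp_iff {X Y : Sp.{v}} :
    HomotopyEquivalent X Y ↔ HomotopyEquivalent X.obj Y.obj :=
  ⟨fun ⟨f, g, h₁, h₂⟩ => ⟨f.hom, g.hom, h₁, h₂⟩,
    fun ⟨f, g, h₁, h₂⟩ => ⟨ObjectProperty.homMk f, ObjectProperty.homMk g, h₁, h₂⟩⟩

theorem hocolimsDistributeOverBinaryProducts_sp :
    HocolimsDistributeOverBinaryProducts Sp.{v} where
  fibrant := isFibrantSimplicialCategory_sp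
  hasFibrantHocolims := hasFibrantHocolims_sp
  hasBinaryProducts := hasBinaryProducts_sp
  distribute J₁ J₂ _ _ D₁ D₂ H₁ H₂ H h₁ h₂ h := by
    have := hasBinaryProducts_sp.{v}
    obtain ⟨R₁, i₁, hi₁, hR₁⟩ := exists_anodyne_kanComplex (hocolimS (D₁ ⋙ ObjectProperty.ι _))
    obtain ⟨R₂, i₂, hi₂, hR₂⟩ := exists_anodyne_kanComplex (hocolimS (D₂ ⋙ ObjectProperty.ι _))
    have e₁ := h₁.homotopyEquivalent (isFibrantHocolim_of_anodyne D₁ ⟨R₁, hR₁⟩ i₁ hi₁)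
    have e₂ := h₂.homotopyEquivalent (isFibrantHocolim_of_anodyne D₂ ⟨R₂, hR₂⟩ i₂ hi₂)
    -- The map from the bar construction of the product diagram to `R₁ ⊗ R₂` consists of two
    -- isomorphisms followed by `i₁` and `i₂`, each multiplied by an object, so it is anodyne.
    have e := h.homotopyEquivalent (isFibrantHocolim_of_anodyne (prodDiagram D₁ D₂)
      ⟨R₁ ⊗ R₂, kanComplex_tensor R₁ R₂⟩
      ((hocolimS.mapIso (prodDiagramIso D₁ D₂)).hom ≫ (hocolimTensorIso _ _).hom ≫
        i₁ ▷ _ ≫ _ ◁ i₂)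
      (MorphismProperty.comp_mem _ _ _ (.of_isIso _) (MorphismProperty.comp_mem _ _ _ (.of_isIso _)
        (MorphismProperty.comp_mem _ _ _ (hi₁.whiskerRight _) (hi₂.whiskerLeft _)))))
    rw [homotopyEquivalent_sp_iff] at e e₁ e₂ ⊢
    exact e.trans ((e₁.tensor e₂).symm.trans (HomotopyEquivalent.of_iso (prodSpIso H₁ H₂)).symm)

end

end HomotopyColimits

theorem proposition4p2 :
    HomotopyColimits.HocolimsDistributeOverBinaryProducts HomotopyColimits.Sp.{v} :=
  HomotopyColimits.hocolimsDistributeOverBinaryProducts_sp
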